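/- Let $S$ be a smooth $k$-dimensional manifold (Hausdorff, second countable) with a smooth positive volume element $ds$, and let $\operatorname{Emb}(S,\mathbb R^n)$ be the set of smooth embeddings $Q:S\to\mathbb R^n$. A tangent vector at $Q$ is a smooth map $V:S\to\mathbb R^n$; a cotangent vector is a smooth compactly supported map $P:S\to(\mathbb R^n)^*$ (any smooth map if $S$ is compact), paired with $V$ by $\int_S P_i(s)V^i(s)\,ds$. Let $\operatorname{Diff}(\mathbb R^n)$ act on embeddings by $\eta\cdot Q=\eta\circ Q$, let it act on $T^*\operatorname{Emb}(S,\mathbb R^n)=\{(Q,P)\}$ by the cotangent lift $\eta\cdot(Q,P)=(\eta\circ Q,\;P\circ (D\eta(Q))^{-1})$, and let it act diagonally on $T^*\operatorname{Emb}(S,\mathbb R^n)^N$, which carries the canonical symplectic form $\Omega((\delta Q,\delta P),(\delta Q',\delta P'))=\sum_a\int_S(\delta P'^a\cdot\delta Q^a-\delta P^a\cdot\delta Q'^a)\,ds$ and the corresponding Poisson bracket. Let $\mathfrak X(\mathbb R^n)$ be the space of smooth vector fields with the $C^\infty$ topology, the Lie algebra of $\operatorname{Diff}(\mathbb R^n)$,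 with continuous dual $\mathfrak X(\mathbb R^n)^*$. Then the measure-valued ansatz $m=\sum_{a=1}^N\int_S P^a(s)\,\delta(x-Q^a(s))\,ds$, an $(\mathbb R^n)^*$-valued measure on $\mathbb R^n$, defines by $\langle J(Q,P),X\rangle=\int_{\mathbb R^n}X^i(x)\,m_i(dx)$ a map $J_{\rm Sing}:T^*\operatorname{Emb}(S,\mathbb R^n)^N\to\mathfrak X(\mathbb R^n)^*$ with $$\langle J(Q,P),X\rangle=\sum_{a=1}^N\int_S P^a_i(s)\,X^i(Q^a(s))\,ds ,$$ and $J_{\rm Sing}$ is an equivariant momentum map for the lifted action. That is, for every $X\in\mathfrak X(\mathbb R^n)$: the infinitesimal generators associated with $X$ exist on $\operatorname{Emb}(S,\mathbb R^n)^N$ and on $T^*\operatorname{Emb}(S,\mathbb R^n)^N$ (they are the velocities at $t=0$ of $\eta_t\cdot q$, respectively $\eta_t\cdot z$, for every smooth curve $\eta_t$ of diffeomorphisms with $\eta_0=\mathrm{id}$ and $\partial_t\eta_t|_{t=0}=X$; such curves exist); the generator $X_P$ on the cotangent bundle satisfies $d\langle J,X\rangle=\Omega(X_P,\cdot)$ and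 $\{F,\langle J,X\rangle\}=X_P[F]$ for all $F$ with functional derivatives; the generator $X_{\operatorname{Emb}}$ satisfies $\langle J(\alpha_q),X\rangle=\langle\alpha_q,X_{\operatorname{Emb}}(q)\rangle$; and $J(\eta\cdot z)=\operatorname{Ad}^*_{\eta^{-1}}J(z)$ for all $\eta\in\operatorname{Diff}(\mathbb R^n)$, that is, $\langle J(\eta\cdot z),X\rangle=\langle J(z),\operatorname{Ad}_{\eta^{-1}}X\rangle$, where $\operatorname{Ad}_\eta X=D\eta\circ X\circ\eta^{-1}$. -/

import Mathlib

open MeasureTheory Topology Manifold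
open scoped ContDiff

noncomputable section

namespace SingMom

/-- Euclidean space `ℝⁿ`. -/
abbrev Rn (n : ℕ) : Type := EuclideanSpace ℝ (Fin n)

/-! ### The diffeomorphism group of `ℝⁿ` -/

/-- The group `Diff(ℝⁿ)` of smooth diffeomorphisms of `ℝⁿ`. -/
abbrev DiffRn (n : ℕ) : Type := Rn n ≃ₘ^∞⟮𝓘(ℝ, Rn n), 𝓘(ℝ, Rn n)⟯ Rn n

/-- The group structure of `Diff(ℝⁿ)`; the product is composition. -/
instance instGroupDiffRn (n : ℕ) : Group (DiffRn n) where
  mul η ζ := ζ.trans η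
  one := Diffeomorph.refl _ _ _
  inv η := η.symm
  mul_assoc _ _ _ := rfl
  one_mul _ := Diffeomorph.ext fun _ => rfl
  mul_one _ := Diffeomorph.ext fun _ => rfl
  inv_mul_cancel η := Diffeomorph.ext fun x => η.symm_apply_apply x

/-! ### Smooth vector fields on `ℝⁿ` and their dual -/

/-- The smooth maps `ℝⁿ → ℝⁿ`, as a linear subspace of all maps. -/
def smoothSubmodule (n : ℕ) : Submodule ℝ (Rn n → Rn n) where
  carrier := {X | ContDiff ℝ ∞ X}
  add_mem' {X Y} (hX : ContDiff ℝ ∞ X) (hY : ContDiff ℝ ∞ Y) := hX.add hY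
  zero_mem' := (contDiff_const : ContDiff ℝ ∞ fun _ : Rn n => (0 : Rn n))
  smul_mem' c X (hX : ContDiff ℝ ∞ X) := hX.const_smul c

/-- The space `𝔛(ℝⁿ)` of smooth vector fields on `ℝⁿ`. -/
def VF (n : ℕ) : Type := ↥(smoothSubmodule n)

instance (n : ℕ) : AddCommGroup (VF n) := inferInstanceAs (AddCommGroup ↥(smoothSubmodule n))

instance (n : ℕ) : Module ℝ (VF n) := inferInstanceAs (Module ℝ ↥(smoothSubmodule n))

instance (n : ℕ) : CoeFun (VF n) (fun _ => Rn n → Rn n) := ⟨fun X => X.1⟩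

/-- The `m`-th derivative of a smooth vector field, as a continuous map. -/
def VF.jet {n : ℕ} (m : ℕ) (X : VF n) : C(Rn n, Rn n [×m]→L[ℝ] Rn n) where
  toFun := iteratedFDeriv ℝ m X.1
  continuous_toFun :=
    ContDiff.continuous_iteratedFDeriv (n := ∞) (by exact_mod_cast le_top) X.2

/-- The `C^∞` topology on `𝔛(ℝⁿ)`: uniform convergence of all derivatives on compact sets. The dual
`𝔛(ℝⁿ)*` is `VF n →L[ℝ] ℝ`, formed with respect to this topology. -/
instance (n : ℕ) : TopologicalSpace (VF n) :=
  ⨅ m : ℕ, TopologicalSpace.induced (VF.jet m) inferInstance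

/-- The adjoint action of `Diff(ℝⁿ)` on its Lie algebra `𝔛(ℝⁿ)`, that is, the push-forward of
vector fields: `Ad_η X = Dη ∘ X ∘ η⁻¹`. -/
def Ad {n : ℕ} (η : DiffRn n) (X : VF n) : VF n :=
  ⟨fun x => fderiv ℝ η (η⁻¹ x) (X (η⁻¹ x)), by
    have h1 : ContDiff ℝ ∞ (fun x => (η⁻¹ : DiffRn n) x) := (η⁻¹ : DiffRn n).contDiff
    have h2 : ContDiff ℝ ∞ (fderiv ℝ η) := η.contDiff.fderiv_right (by simp)
    have h3 : ContDiff ℝ ∞ X.1 := X.2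
    exact (h2.comp h1).clm_apply (h3.comp h1)⟩

/-- A smooth curve `t ↦ η_t` of diffeomorphisms with `η_0 = id` and `∂_t η_t = X` at `t = 0`. -/
structure IsDiffCurve {n : ℕ} (η : ℝ → DiffRn n) (X : VF n) : Prop where
  zero : η 0 = 1
  smooth : ContDiff ℝ ∞ (fun p : ℝ × Rn n => η p.1 p.2)
  velocity : ∀ x, HasDerivAt (fun t => η t x) (X x) 0

/-! ### Embeddings, tangent vectors and cotangent vectors

`S` is a manifold of dimension `k`. -/

section Embeddings

variable (k n : ℕ) (S : Type*) [TopologicalSpace S] [ChartedSpace (Rn k) S]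

/-- The set `Emb(S, ℝⁿ)` of smooth embeddings. -/
structure Emb where
  toFun : S → Rn n
  isSmoothEmbedding : IsSmoothEmbedding (𝓡 k) 𝓘(ℝ, Rn n) ∞ toFun

/-- An element of `T_Q Emb(S, ℝⁿ)`: a smooth vector field over `Q`, that is, a smooth map
`V : S → ℝⁿ`. -/
structure TanEmb where
  toFun : S → Rn n
  smooth : ContMDiff (𝓡 k) 𝓘(ℝ, Rn n) ∞ toFun

/-- A one-form density over an embedding (relative to the fixed volume element of `S`): a
smooth map `P : S → (ℝⁿ)*`. Its support is compact, so that it pairs with all smooth `V : S → ℝⁿ`;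
this is no restriction if `S` is compact. -/
structure Mom where
  toFun : S → (Rn n →L[ℝ] ℝ)
  smooth : ContMDiff (𝓡 k) 𝓘(ℝ, Rn n →L[ℝ] ℝ) ∞ toFun
  compact : HasCompactSupport toFun

/-- The cotangent bundle `T*Emb(S, ℝⁿ)`: pairs `(Q, P)`. -/
structure CotEmb where
  Q : Emb k n S
  P : Mom k n S

/-- A tangent vector `(δQ, δP)` to `T*Emb(S, ℝⁿ)`. -/
structure TanCot where
  dQ : TanEmb k n S
  dP : Mom k n S

end Embeddings

variable {k n N : ℕ} {S : Type*} [TopologicalSpace S] [ChartedSpace (Rn k) S]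

instance : CoeFun (Emb k n S) (fun _ => S → Rn n) := ⟨Emb.toFun⟩
instance : CoeFun (TanEmb k n S) (fun _ => S → Rn n) := ⟨TanEmb.toFun⟩
instance : CoeFun (Mom k n S) (fun _ => S → (Rn n →L[ℝ] ℝ)) := ⟨Mom.toFun⟩

/-! ### The action of `Diff(ℝⁿ)` and its cotangent lift -/

theorem isSmoothEmbedding_comp (η : DiffRn n) {Q : S → Rn n}
    (hQ : IsSmoothEmbedding (𝓡 k) 𝓘(ℝ, Rn n) ∞ Q) :
    IsSmoothEmbedding (𝓡 k) 𝓘(ℝ, Rn n) ∞ (η ∘ Q) := by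
  refine ⟨?_, η.toHomeomorph.isEmbedding.comp hQ.isEmbedding⟩
  obtain ⟨F, hF1, hF2, hF⟩ := hQ.isImmersion
  refine ⟨F, hF1, hF2, fun x => ?_⟩
  have h := hF x
  refine IsImmersionAtOfComplement.mk_of_charts h.equiv h.domChart
    (η.symm.toHomeomorph.toOpenPartialHomeomorph.trans h.codChart) h.mem_domChart_source ?_
    h.domChart_mem_maximalAtlas ?_ ?_ ?_
  · simpa using h.mem_codChart_source
  · have hc := h.codChart_mem_maximalAtlas
    have hη : η.symm.toHomeomorph.toOpenPartialHomeomorph ∈ contDiffGroupoid ∞ 𝓘(ℝ, Rn n) := by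
      rw [contDiffGroupoid, mem_groupoid_of_pregroupoid]
      constructor
      · simpa [contDiffPregroupoid] using η.symm.contDiff.contDiffOn
      · simpa [contDiffPregroupoid] using η.contDiff.contDiffOn
    have hc' : h.codChart ∈ contDiffGroupoid ∞ 𝓘(ℝ, Rn n) := by
      have := IsManifold.compatible_of_mem_maximalAtlas
        ((contDiffGroupoid ∞ 𝓘(ℝ, Rn n)).id_mem_maximalAtlas) hc
      simpa using this
    exact (contDiffGroupoid ∞ 𝓘(ℝ, Rn n)).mem_maximalAtlas_of_mem_groupoid
      ((contDiffGroupoid ∞ 𝓘(ℝ, Rn n)).trans hη hc')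
  · intro y hy
    have := h.source_subset_preimage_source hy
    simpa using this
  · intro y hy
    have := h.writtenInCharts hy
    simpa using this

/-- The left action `η · Q = η ∘ Q`. -/
instance : MulAction (DiffRn n) (Emb k n S) where
  smul η Q := ⟨η ∘ Q, isSmoothEmbedding_comp η Q.isSmoothEmbedding⟩
  one_smul _ := rfl
  mul_smul _ _ _ := rfl

/-- The tangent map of `Q ↦ η ∘ Q`, which sends `V ∈ T_Q Emb` to `Dη(Q) V ∈ T_{η ∘ Q} Emb`. -/
def tangentMap (η : DiffRn n) (Q : Emb k n S) (V : TanEmb k n S) : TanEmb k n S :=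
  ⟨fun s => fderiv ℝ η (Q s) (V s), by
    have h2 : ContDiff ℝ ∞ (fderiv ℝ η) := η.contDiff.fderiv_right (by simp)
    exact (h2.contMDiff.comp Q.isSmoothEmbedding.contMDiff).clm_apply V.smooth⟩

/-- The momentum component of the cotangent lift: `(η · P)(s) = P(s) ∘ D(η⁻¹)(η(Q(s)))`, so that
`⟨η · (Q, P), V⟩ = ⟨(Q, P), T(η⁻¹) V⟩`. -/
def liftMom (η : DiffRn n) (z : CotEmb k n S) : Mom k n S :=
  ⟨fun s => (z.P s).comp (fderiv ℝ (η⁻¹ : DiffRn n) (η (z.Q s))), by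
    have h2 : ContDiff ℝ ∞ (fderiv ℝ (η⁻¹ : DiffRn n)) :=
      (η⁻¹ : DiffRn n).contDiff.fderiv_right (by simp)
    exact z.P.smooth.clm_comp
      ((h2.comp η.contDiff).contMDiff.comp z.Q.isSmoothEmbedding.contMDiff), by
    refine z.P.compact.mono fun s hs => ?_
    simp only [Function.mem_support] at hs ⊢
    intro h
    exact hs (by rw [h, ContinuousLinearMap.zero_comp])⟩

theorem CotEmb.ext' {z w : CotEmb k n S} (hQ : ∀ s, z.Q s = w.Q s) (hP : ∀ s, z.P s = w.P s) :
    z = w := by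
  obtain ⟨⟨Q, _⟩, ⟨P, _, _⟩⟩ := z
  obtain ⟨⟨Q', _⟩, ⟨P', _, _⟩⟩ := w
  obtain rfl : Q = Q' := funext hQ
  obtain rfl : P = P' := funext hP
  rfl

/-- The cotangent lift to `T*Emb(S, ℝⁿ)` of the left action on `Emb(S, ℝⁿ)`. -/
instance : MulAction (DiffRn n) (CotEmb k n S) where
  smul η z := ⟨η • z.Q, liftMom η z⟩
  one_smul z := CotEmb.ext' (fun _ => rfl) fun s => by
    change (z.P s).comp (fderiv ℝ (id : Rn n → Rn n) _) = z.P s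
    rw [fderiv_id]
    exact ContinuousLinearMap.comp_id _
  mul_smul η ζ z := CotEmb.ext' (fun _ => rfl) fun s => by
    change (z.P s).comp (fderiv ℝ ((ζ⁻¹ : DiffRn n) ∘ (η⁻¹ : DiffRn n)) (η (ζ (z.Q s)))) =
      ((z.P s).comp (fderiv ℝ (ζ⁻¹ : DiffRn n) (ζ (z.Q s)))).comp
        (fderiv ℝ (η⁻¹ : DiffRn n) (η (ζ (z.Q s))))
    have h : (η⁻¹ : DiffRn n) (η (ζ (z.Q s))) = ζ (z.Q s) := η.symm_apply_apply _
    rw [fderiv_comp _ ((ζ⁻¹ : DiffRn n).contDiff.differentiable (by simp) _)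
      ((η⁻¹ : DiffRn n).contDiff.differentiable (by simp) _), h]
    rfl

/-! ### Curves, infinitesimal generators

The configuration space of `N` components is `Emb(S, ℝⁿ)^N`; its cotangent bundle is
`T*Emb(S, ℝⁿ)^N`. Both carry the diagonal action of `Diff(ℝⁿ)`. -/

/-- `c` is a smooth curve in `Emb(S, ℝⁿ)^N` with `c(0) = Q` and velocity `V` at `t = 0`. -/
structure HasEmbVelocity (c : ℝ → Fin N → Emb k n S) (Q : Fin N → Emb k n S)
    (V : Fin N → TanEmb k n S) : Prop where
  smooth : ∀ a, ContMDiff (𝓘(ℝ, ℝ).prod (𝓡 k)) 𝓘(ℝ, Rn n) ∞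
    (fun p : ℝ × S => c p.1 a p.2)
  zero : c 0 = Q
  velocity : ∀ a s, HasDerivAt (fun t => c t a s) (V a s) 0

/-- `c` is a smooth curve in `T*Emb(S, ℝⁿ)^N` with `c(0) = z` and velocity `v` at `t = 0`. The
supports of the momenta stay in a compact set, locally uniformly in time. -/
structure HasCotVelocity (c : ℝ → Fin N → CotEmb k n S) (z : Fin N → CotEmb k n S)
    (v : Fin N → TanCot k n S) : Prop where
  smooth_Q : ∀ a, ContMDiff (𝓘(ℝ, ℝ).prod (𝓡 k)) 𝓘(ℝ, Rn n) ∞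
    (fun p : ℝ × S => (c p.1 a).Q p.2)
  smooth_P : ∀ a, ContMDiff (𝓘(ℝ, ℝ).prod (𝓡 k)) 𝓘(ℝ, Rn n →L[ℝ] ℝ) ∞
    (fun p : ℝ × S => (c p.1 a).P p.2)
  support : ∀ a t₀, ∃ K : Set S, IsCompact K ∧ ∀ᶠ t in 𝓝 t₀, ∀ s ∉ K, (c t a).P s = 0
  zero : c 0 = z
  velocity_Q : ∀ a s, HasDerivAt (fun t => (c t a).Q s) ((v a).dQ s) 0
  velocity_P : ∀ a s, HasDerivAt (fun t => (c t a).P s) ((v a).dP s) 0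

/-- `V` is the infinitesimal generator of the action on `Emb(S, ℝⁿ)^N`, at `Q`, associated with
`X ∈ 𝔛(ℝⁿ)`: the derivative of `η · Q` with respect to `η` at the identity in the
direction `X`. -/
def IsEmbGenerator (X : VF n) (Q : Fin N → Emb k n S) (V : Fin N → TanEmb k n S) : Prop :=
  (∃ η : ℝ → DiffRn n, IsDiffCurve η X) ∧
    ∀ η : ℝ → DiffRn n, IsDiffCurve η X → HasEmbVelocity (fun t => η t • Q) Q V

/-- `v` is the infinitesimal generator of the lifted action on `T*Emb(S, ℝⁿ)^N`, at `z`,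
associated with `X ∈ 𝔛(ℝⁿ)`. -/
def IsCotGenerator (X : VF n) (z : Fin N → CotEmb k n S) (v : Fin N → TanCot k n S) : Prop :=
  (∃ η : ℝ → DiffRn n, IsDiffCurve η X) ∧
    ∀ η : ℝ → DiffRn n, IsDiffCurve η X → HasCotVelocity (fun t => η t • z) z v

/-! ### The volume element, the pairing, the canonical symplectic and Poisson structures -/

variable [MeasurableSpace S]

variable (k) in
/-- `μ` is a (smooth, positive) volume element of `S`: in each chart it has a smooth positive
density with respect to Lebesgue measure. -/
def IsVolumeElement (μ : Measure S) : Prop :=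
  ∀ e ∈ atlas (Rn k) S, ∃ ρ : Rn k → ℝ, ContDiffOn ℝ ∞ ρ e.target ∧ (∀ y ∈ e.target, 0 < ρ y) ∧
    ∀ A : Set S, MeasurableSet A → A ⊆ e.source →
      μ A = ∫⁻ y in e '' A, ENNReal.ofReal (ρ y)

/-- The natural pairing `⟨P, V⟩ = ∑_a ∫_S P^a(s) · V^a(s) ds` of `T*_Q` and `T_Q`. -/
def pairing (μ : Measure S) (P : Fin N → Mom k n S) (V : Fin N → TanEmb k n S) : ℝ :=
  ∑ a, ∫ s, P a s (V a s) ∂μ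

/-- The canonical symplectic form on `T*Emb(S, ℝⁿ)^N`:
`Ω((δQ₁, δP₁), (δQ₂, δP₂)) = ⟨δP₂, δQ₁⟩ - ⟨δP₁, δQ₂⟩`. -/
def symplecticForm (μ : Measure S) (v w : Fin N → TanCot k n S) : ℝ :=
  pairing μ (fun a => (w a).dP) (fun a => (v a).dQ) -
    pairing μ (fun a => (v a).dP) (fun a => (w a).dQ)

/-- `F` is differentiable at `z` with functional derivatives `A = δF/δQ` and `B = δF/δP`. -/
def HasFunctionalDeriv (μ : Measure S) (F : (Fin N → CotEmb k n S) → ℝ) (z : Fin N → CotEmb k n S)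
    (A : Fin N → Mom k n S) (B : Fin N → TanEmb k n S) : Prop :=
  ∀ (c : ℝ → Fin N → CotEmb k n S) (v : Fin N → TanCot k n S), HasCotVelocity c z v →
    HasDerivAt (fun t => F (c t))
      (pairing μ A (fun a => (v a).dQ) + pairing μ (fun a => (v a).dP) B) 0

/-- The canonical Poisson bracket `{F, G} = ⟨δF/δQ, δG/δP⟩ - ⟨δG/δQ, δF/δP⟩`, in terms of
the functional derivatives `A = δF/δQ`, `B = δF/δP`, `A' = δG/δQ`, `B' = δG/δP`. -/
def poissonBracket (μ : Measure S) (A : Fin N → Mom k n S) (B : Fin N → TanEmb k n S)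
    (A' : Fin N → Mom k n S) (B' : Fin N → TanEmb k n S) : ℝ :=
  pairing μ A B' - pairing μ A' B

/-! ### Momentum maps -/

/-- `J : T*Emb(S, ℝⁿ)^N → 𝔛(ℝⁿ)*` is a momentum map for the cotangent lift of the action of
`Diff(ℝⁿ)`. -/
structure IsMomentumMap (μ : Measure S) (J : (Fin N → CotEmb k n S) → (VF n →L[ℝ] ℝ)) : Prop where
  /-- The infinitesimal generator of the lifted action associated with `X` is the Hamiltonian
  vector field of `⟨J, X⟩`: `d⟨J, X⟩ = Ω(X_P, ·)`. -/
  hamiltonian : ∀ (X : VF n) (z : Fin N → CotEmb k n S), ∃ v : Fin N → TanCot k n S,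
    IsCotGenerator X z v ∧
      ∀ (c : ℝ → Fin N → CotEmb k n S) (w : Fin N → TanCot k n S), HasCotVelocity c z w →
        HasDerivAt (fun t => J (c t) X) (symplecticForm μ v w) 0
  /-- `{F, ⟨J, X⟩} = X_P[F]` for all `F`. -/
  poisson : ∀ (X : VF n) (z : Fin N → CotEmb k n S),
    ∃ (A' : Fin N → Mom k n S) (B' : Fin N → TanEmb k n S),
      HasFunctionalDeriv μ (fun w => J w X) z A' B' ∧
        ∀ (F : (Fin N → CotEmb k n S) → ℝ) (A : Fin N → Mom k n S) (B : Fin N → TanEmb k n S),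
          HasFunctionalDeriv μ F z A B → ∀ η : ℝ → DiffRn n, IsDiffCurve η X →
            HasDerivAt (fun t => F (η t • z)) (poissonBracket μ A B A' B') 0
  /-- The formula `⟨J(α_q), X⟩ = ⟨α_q, X_Q(q)⟩` for the momentum map of a cotangent lift. -/
  cotangent : ∀ (X : VF n) (z : Fin N → CotEmb k n S), ∃ V : Fin N → TanEmb k n S,
    IsEmbGenerator X (fun a => (z a).Q) V ∧ J z X = pairing μ (fun a => (z a).P) V

/-- Equivariance with respect to the lifted action and the coadjoint action:
`J(η · z) = Ad*_{η⁻¹} J(z)`. -/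
def IsEquivariant (J : (Fin N → CotEmb k n S) → (VF n →L[ℝ] ℝ)) : Prop :=
  ∀ (η : DiffRn n) (z : Fin N → CotEmb k n S) (X : VF n), J (η • z) X = J z (Ad η⁻¹ X)

/-! ### The measure-valued ansatz -/

/-- The measure-valued momentum `m = ∑_a ∫_S P^a(s) δ(x - Q^a(s)) ds`: the `(ℝⁿ)*`-valued measure on
`ℝⁿ` with `m(B) = ∑_a ∫_{Q^a(s) ∈ B} P^a(s) ds`. -/
def ansatz (μ : Measure S) (z : Fin N → CotEmb k n S) : VectorMeasure (Rn n) (Rn n →L[ℝ] ℝ) :=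
  ∑ a, (μ.withDensityᵥ (z a).P).map (z a).Q

/-- The `L²` pairing `⟨m, X⟩ = ∫_{ℝⁿ} X^i(x) m_i(dx)` of an `(ℝⁿ)*`-valued measure with a vector
field. -/
def measurePairing (m : VectorMeasure (Rn n) (Rn n →L[ℝ] ℝ)) (X : Rn n → Rn n) : ℝ :=
  m.integral X (ContinuousLinearMap.id ℝ (Rn n →L[ℝ] ℝ)).flip

end SingMom

end

/-!
The functional `J(Q, P) : X ↦ ∑_a ∫_S P^a · X(Q^a) ds` is the pairing of `P` with `X ∘ Q`, and
`X ∘ Q` is the generator of `X` on embeddings. So the formula for the momentum map of a cotangent lift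
holds by construction, and equivariance is immediate from the definition of the lift. Three points
carry analytic content.

*Generators exist.* A smooth field `X` on `ℝⁿ` need not be complete, so its flow is not available as a
curve of diffeomorphisms. Only the velocity at `t = 0` matters, and `exists_isDiffCurve` uses instead
`η_t = id + φ_t X`, with `φ_t = t g² / (g² + t²)` and a smooth `g > 0` decaying so fast that `φ_t X` is
a contraction for all `t`. For an arbitrary curve with velocity `X`, the generator on the cotangent
bundle is `(X ∘ Q, -P ∘ DX(Q))`: the derivative of `Dη_t` at `t = 0` is `DX` by the symmetry of second
derivatives, and that of its inverse is `-DX`.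

*The Hamiltonian property.* Differentiating `∫_S P_t · X(Q_t) ds` under the integral sign, which is
allowed because the supports of `P_t` stay in a compact set of finite volume, gives the functional
derivatives `δ⟨J, X⟩/δQ = P ∘ DX(Q)` and `δ⟨J, X⟩/δP = X ∘ Q`
(`hasFunctionalDeriv_singularMomentum`). Comparison with the generator yields both `d⟨J, X⟩ = Ω(X_P, ·)`
and `{F, ⟨J, X⟩} = X_P[F]`.

*The ansatz.* The variation of the vector measure with density `P` is the measure with density `‖P‖`,
which is finite and lives on the compact support of `P`. Hence every continuous function is integrable
against it, and the integral of `X` against its image under `Q` is `∫_S P · X(Q) ds`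
(`measurePairing_ansatz`).
-/

namespace SingMom

/-! ### Curves of diffeomorphisms with prescribed velocity -/

theorem VF.contDiff {n : ℕ} (X : VF n) : ContDiff ℝ ∞ X.1 := X.2

/-- A non-increasing positive function, continuous or not, bounds some smooth positive function
together with the absolute value of its derivative. -/
theorem exists_smooth_pos_le_of_antitone {ε : ℝ → ℝ} (hε : Antitone ε) (hpos : ∀ r, 0 < ε r) :
    ∃ ψ : ℝ → ℝ, ContDiff ℝ ∞ ψ ∧ (∀ r, 0 < ψ r) ∧ (∀ r, ψ r ≤ ε r) ∧ ∀ r, |deriv ψ r| ≤ ε r := by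
  obtain ⟨b, hb⟩ : ∃ b : C^∞⟮𝓘(ℝ, ℝ), ℝ; 𝓘(ℝ, ℝ), ℝ⟯, ∀ r, b r ∈ Set.Ioc 0 (ε r) := by
    refine exists_contMDiffMap_forall_mem_convex_of_local_const 𝓘(ℝ, ℝ)
      (fun r => convex_Ioc 0 (ε r)) fun r => ⟨ε (r + 1), ?_⟩
    filter_upwards [Iio_mem_nhds (lt_add_one r)] with y hy
    exact ⟨hpos _, hε (le_of_lt hy)⟩
  have hbs : ContDiff ℝ ∞ (b : ℝ → ℝ) := b.contMDiff.contDiff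
  -- With `B` a primitive of `b`, the average `B (r + 1) - B r` of `b` over `[r, r + 1]` is bounded by
  -- `ε r`, and so is its derivative `b (r + 1) - b r`, whatever the derivative of `b` is.
  set B : ℝ → ℝ := fun r => ∫ u in (0 : ℝ)..r, b u
  have hB : ∀ r, HasDerivAt B (b r) r := fun r =>
    intervalIntegral.integral_hasDerivAt_right (hbs.continuous.intervalIntegrable _ _)
      (hbs.continuous.stronglyMeasurableAtFilter _ _) hbs.continuous.continuousAt
  have hBs : ContDiff ℝ ∞ B := by
    rw [contDiff_infty_iff_deriv]
    refine ⟨fun r => (hB r).differentiableAt, ?_⟩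
    rwa [show deriv B = b from funext fun r => (hB r).deriv]
  have hmv : ∀ r, ∃ c ∈ Set.Ioo r (r + 1), b c = B (r + 1) - B r := fun r => by
    obtain ⟨c, hc, h⟩ := exists_hasDerivAt_eq_slope B b (lt_add_one r)
      hBs.continuous.continuousOn fun x _ => hB x
    exact ⟨c, hc, by simpa using h⟩
  have hder : ∀ r, HasDerivAt (fun r => B (r + 1) - B r) (b (r + 1) - b r) r := fun r =>
    ((hB (r + 1)).comp_add_const r 1).sub (hB r)
  refine ⟨fun r => B (r + 1) - B r, ?_, fun r => ?_, fun r => ?_, fun r => ?_⟩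
  · exact (hBs.comp (contDiff_id.add contDiff_const)).sub hBs
  · obtain ⟨c, -, h⟩ := hmv r
    exact (hb c).1.trans_eq h
  · obtain ⟨c, hc, h⟩ := hmv r
    exact h.symm.le.trans ((hb c).2.trans (hε hc.1.le))
  · rw [(hder r).deriv, abs_le]
    have h1 := hb r
    have h2 := hb (r + 1)
    have h3 := hε (le_of_lt (lt_add_one r))
    constructor <;> linarith [h1.1, h1.2, h2.1, h2.2]

/-- There are smooth positive functions on `ℝⁿ` that, along with their first derivative, decay
faster than a prescribed continuous rate. -/
theorem exists_smooth_pos_small {n : ℕ} {A : Rn n → ℝ} (hA : Continuous A) (hA0 : ∀ x, 0 ≤ A x) :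
    ∃ g : Rn n → ℝ, ContDiff ℝ ∞ g ∧ (∀ x, 0 < g x) ∧ (∀ x, g x * A x ≤ 1) ∧
      ∀ x, ‖fderiv ℝ g x‖ * A x ≤ 1 := by
  set C : Rn n → ℝ := fun x => (1 + 2 * ‖x‖) * A x with hC
  have hCc : Continuous C := by fun_prop
  have hC0 : ∀ x, 0 ≤ C x := fun x => mul_nonneg (by positivity) (hA0 x)
  set M : ℝ → ℝ := fun r => sSup (C '' Metric.closedBall 0 (Real.sqrt r)) with hM
  have hbdd : ∀ r, BddAbove (C '' Metric.closedBall 0 (Real.sqrt r)) := fun r =>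
    ((isCompact_closedBall _ _).image hCc).bddAbove
  have hle : ∀ x, C x ≤ M (‖x‖ ^ 2) := fun x =>
    le_csSup (hbdd _) ⟨x, by simp [Real.sqrt_sq (norm_nonneg x)], rfl⟩
  have hM0 : ∀ r, 0 ≤ M r := fun r => Real.sSup_nonneg (by rintro _ ⟨x, -, rfl⟩; exact hC0 x)
  have hmono : Monotone M := fun r s h =>
    csSup_le_csSup (hbdd s) ⟨C 0, 0, by simp, rfl⟩
      (Set.image_mono (Metric.closedBall_subset_closedBall (Real.sqrt_le_sqrt h)))
  -- Take `g x = ψ (‖x‖ ^ 2)`; the factor `2 * ‖x‖` in `C` absorbs the derivative of `‖x‖ ^ 2`.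
  obtain ⟨ψ, hψs, hψ0, hψ1, hψ2⟩ := exists_smooth_pos_le_of_antitone (ε := fun r => (1 + M r)⁻¹)
    (fun r s h => inv_anti₀ (by linarith [hM0 r]) (by linarith [hmono h]))
    (fun r => inv_pos.2 (by linarith [hM0 r]))
  have hsq : ContDiff ℝ ∞ fun x : Rn n => ‖x‖ ^ 2 := contDiff_norm_sq ℝ
  have key : ∀ x, (1 + M (‖x‖ ^ 2))⁻¹ * C x ≤ 1 := fun x => by
    rw [inv_mul_le_one₀ (by linarith [hM0 (‖x‖ ^ 2)])]
    linarith [hle x]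
  have hCA : ∀ x, C x = A x + 2 * ‖x‖ * A x := fun x => by simp only [hC]; ring
  refine ⟨fun x => ψ (‖x‖ ^ 2), hψs.comp hsq, fun x => hψ0 _, fun x => ?_, fun x => ?_⟩
  · refine le_trans (mul_le_mul (hψ1 _) ?_ (hA0 x) (inv_pos.2 (by linarith [hM0 (‖x‖ ^ 2)])).le)
      (key x)
    have := mul_nonneg (norm_nonneg x) (hA0 x)
    linarith [hCA x]
  · have h1 : HasFDerivAt (fun x : Rn n => ψ (‖x‖ ^ 2))
        (deriv ψ (‖x‖ ^ 2) • (2 • innerSL ℝ x)) x :=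
      ((hψs.differentiable (by simp) _).hasDerivAt).comp_hasFDerivAt x
        (hasStrictFDerivAt_norm_sq x).hasFDerivAt
    rw [h1.fderiv]
    have h2 : ‖deriv ψ (‖x‖ ^ 2) • (2 • innerSL ℝ x)‖ ≤ (1 + M (‖x‖ ^ 2))⁻¹ * (2 * ‖x‖) := by
      rw [norm_smul]
      refine mul_le_mul (hψ2 _) ?_ (norm_nonneg _) (inv_pos.2 (by linarith [hM0 (‖x‖ ^ 2)])).le
      refine (norm_nsmul_le).trans ?_
      simp
    refine (mul_le_mul_of_nonneg_right h2 (hA0 x)).trans (le_trans ?_ (key x))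
    rw [mul_assoc]
    refine mul_le_mul_of_nonneg_left ?_ (inv_pos.2 (by linarith [hM0 (‖x‖ ^ 2)])).le
    linarith [hCA x, hA0 x]

/-- A smooth perturbation of the identity by a map of Lipschitz constant `1 / 2` is a
diffeomorphism. -/
theorem exists_diffeomorph_id_add {n : ℕ} {F : Rn n → Rn n} (hF : ContDiff ℝ ∞ F)
    (hF' : ∀ x, ‖fderiv ℝ F x‖ ≤ 1 / 2) : ∃ η : DiffRn n, ∀ x, η x = x + F x := by
  have hd : ∀ x, HasFDerivAt F (fderiv ℝ F x) x := fun x =>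
    (hF.differentiable (by simp) x).hasFDerivAt
  have happ : ApproximatesLinearOn (fun x => x + F x)
      ((ContinuousLinearEquiv.refl ℝ (Rn n) : Rn n ≃L[ℝ] Rn n) : Rn n →L[ℝ] Rn n)
      Set.univ (1 / 2) := by
    rw [ApproximatesLinearOn.approximatesLinearOn_iff_lipschitzOnWith]
    convert! (lipschitzWith_of_nnnorm_fderiv_le (C := 1 / 2) (fun x => (hd x).differentiableAt)
        (fun x => by rw [← NNReal.coe_le_coe]; simpa using hF' x)).lipschitzOnWith using 1
    ext1 x
    simp
  have hc : Subsingleton (Rn n) ∨ (1 / 2 : NNReal) <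
      ‖((ContinuousLinearEquiv.refl ℝ (Rn n)).symm : Rn n →L[ℝ] Rn n)‖₊⁻¹ := by
    rcases subsingleton_or_nontrivial (Rn n) with h | h
    · exact Or.inl h
    · right
      have : ‖((ContinuousLinearEquiv.refl ℝ (Rn n)).symm : Rn n →L[ℝ] Rn n)‖₊ = 1 := by
        exact ContinuousLinearMap.nnnorm_id (𝕜 := ℝ) (E := Rn n)
      rw [this, inv_one]
      exact NNReal.half_lt_self one_ne_zero
  let h := happ.toHomeomorph _ hc
  have hh : (h : Rn n → Rn n) = fun x => x + F x := rfl
  have hs : ContDiff ℝ ∞ (h : Rn n → Rn n) := by rw [hh]; exact contDiff_id.add hF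
  have hlt : ∀ x, ‖-fderiv ℝ F x‖ < 1 := fun x => by rw [norm_neg]; linarith [hF' x]
  have hder : ∀ x, HasFDerivAt h ((ContinuousLinearEquiv.unitsEquiv ℝ (Rn n)
      (Units.oneSub _ (hlt x)) : Rn n ≃L[ℝ] Rn n) : Rn n →L[ℝ] Rn n) x := fun x => by
    rw [hh]
    convert! (hasFDerivAt_id x).add (hd x) using 1
    ext v
    simp
  exact ⟨⟨h.toEquiv, hs.contMDiff, (h.contDiff_symm hder hs).contMDiff⟩, fun x => rfl⟩

/-- Every smooth vector field is the initial velocity of a smooth curve of diffeomorphisms. The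
flow of `X` will not do, since `X` need not be complete; the curve is
`η_t = id + (t g² / (g² + t²)) X` with `g > 0` decaying so fast that the perturbation of the identity
has Lipschitz constant at most `1 / 2`, uniformly in `t`. -/
theorem exists_isDiffCurve {n : ℕ} (X : VF n) : ∃ η : ℝ → DiffRn n, IsDiffCurve η X := by
  have hX := X.contDiff
  have hdX : Continuous (fderiv ℝ X.1) := hX.continuous_fderiv (by simp)
  obtain ⟨g, hgs, hg0, hgA, hgA'⟩ := exists_smooth_pos_small
    (A := fun x => 4 * (‖fderiv ℝ X.1 x‖ + ‖X.1 x‖))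
    (continuous_const.mul (hdX.norm.add hX.continuous.norm)) (fun x => by positivity)
  set φ : ℝ × Rn n → ℝ := fun p => p.1 * g p.2 ^ 2 / (g p.2 ^ 2 + p.1 ^ 2) with hφ
  have hne : ∀ p : ℝ × Rn n, g p.2 ^ 2 + p.1 ^ 2 ≠ 0 := fun p =>
    ne_of_gt (by have := hg0 p.2; positivity)
  have hg2 : ContDiff ℝ ∞ fun p : ℝ × Rn n => g p.2 := hgs.comp contDiff_snd
  have hφs : ContDiff ℝ ∞ φ :=
    (contDiff_fst.mul (hg2.pow 2)).div ((hg2.pow 2).add (contDiff_fst.pow 2)) hne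
  have hFs : ContDiff ℝ ∞ fun p : ℝ × Rn n => φ p • X.1 p.2 := hφs.smul (hX.comp contDiff_snd)
  have hbound : ∀ t x, ‖fderiv ℝ (fun x => φ (t, x) • X.1 x) x‖ ≤ 1 / 2 := fun t x => by
    have hg := hg0 x
    have hgd : HasFDerivAt g (fderiv ℝ g x) x := (hgs.differentiable (by simp) x).hasFDerivAt
    have h1 : HasDerivAt (fun u : ℝ => t * u ^ 2 / (u ^ 2 + t ^ 2))
        (2 * t ^ 3 * g x / (g x ^ 2 + t ^ 2) ^ 2) (g x) := by
      have := (((hasDerivAt_id (g x)).pow 2).const_mul t).div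
        (((hasDerivAt_id (g x)).pow 2).add_const (t ^ 2)) (hne (t, x))
      convert! this using 1
      simp
      ring
    have h2 : HasFDerivAt (fun x => φ (t, x))
        ((2 * t ^ 3 * g x / (g x ^ 2 + t ^ 2) ^ 2) • fderiv ℝ g x) x :=
      h1.comp_hasFDerivAt x hgd
    have h3 := h2.smul (hX.differentiable (by simp) x).hasFDerivAt
    refine (congrArg norm h3.fderiv).trans_le ?_
    have hpos : 0 < g x ^ 2 + t ^ 2 := by positivity
    have hamgm : 2 * |t| * g x ≤ g x ^ 2 + t ^ 2 := by
      nlinarith [sq_nonneg (g x - |t|), sq_abs t]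
    -- Both bounds are independent of `t`; they follow from `2 |t| g ≤ g² + t²`.
    have b1 : |φ (t, x)| ≤ g x := by
      simp only [hφ]
      rw [abs_div, abs_of_pos hpos, div_le_iff₀ hpos, abs_mul, abs_of_pos (pow_pos hg 2)]
      nlinarith [abs_nonneg t]
    have b2 : |2 * t ^ 3 * g x / (g x ^ 2 + t ^ 2) ^ 2| ≤ 1 := by
      rw [abs_div, abs_of_pos (pow_pos hpos 2), div_le_one (pow_pos hpos 2)]
      have : |2 * t ^ 3 * g x| = (2 * |t| * g x) * t ^ 2 := by
        rw [abs_mul, abs_mul, abs_pow, abs_of_pos hg, abs_two, ← sq_abs t]; ring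
      rw [this]
      nlinarith [sq_nonneg t, sq_nonneg (g x)]
    have c1 : ‖φ (t, x) • fderiv ℝ X.1 x‖ ≤ g x * ‖fderiv ℝ X.1 x‖ := by
      rw [norm_smul]
      exact mul_le_mul_of_nonneg_right b1 (norm_nonneg _)
    have c2 : ‖((2 * t ^ 3 * g x / (g x ^ 2 + t ^ 2) ^ 2) • fderiv ℝ g x).smulRight (X.1 x)‖
        ≤ ‖fderiv ℝ g x‖ * ‖X.1 x‖ := by
      rw [ContinuousLinearMap.norm_smulRight_apply, norm_smul]
      refine mul_le_mul_of_nonneg_right ?_ (norm_nonneg _)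
      exact mul_le_of_le_one_left (norm_nonneg _) b2
    have d1 := hgA x
    have d2 := hgA' x
    have e1 := mul_nonneg hg.le (norm_nonneg (X.1 x))
    have e2 := mul_nonneg (norm_nonneg (fderiv ℝ g x)) (norm_nonneg (fderiv ℝ X.1 x))
    refine (norm_add_le _ _).trans ((add_le_add c1 c2).trans ?_)
    nlinarith
  choose η hη using fun t => exists_diffeomorph_id_add (F := fun x => φ (t, x) • X.1 x)
    (hFs.comp (contDiff_const.prodMk contDiff_id)) (hbound t)
  refine ⟨η, ?_, ?_, fun x => ?_⟩
  · refine Diffeomorph.ext fun x => ?_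
    rw [hη]
    simp [hφ]
    rfl
  · simp_rw [hη]
    exact contDiff_snd.add hFs
  · simp_rw [hη]
    have h1 : HasDerivAt (fun t => φ (t, x)) 1 0 := by
      have := ((hasDerivAt_id (0 : ℝ)).mul_const (g x ^ 2)).div
        (((hasDerivAt_id (0 : ℝ)).pow 2).const_add (g x ^ 2)) (hne (0, x))
      convert! this using 1
      have := (hg0 x).ne'
      simp
      field_simp
    have := (h1.smul_const (X.1 x)).const_add x
    simpa using! this

/-! ### Integration against vector measures with density, and under the integral sign -/

/-- The integral against the vector measure with density `P` is the integral of the pairing with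
`P`. -/
theorem integral_withDensityᵥ {α E F G : Type*} [MeasurableSpace α]
    [NormedAddCommGroup E] [NormedSpace ℝ E] [NormedAddCommGroup F] [NormedSpace ℝ F]
    [CompleteSpace F] [NormedAddCommGroup G] [NormedSpace ℝ G] [CompleteSpace G]
    {μ : Measure α} {P : α → F} (hP : Integrable P μ) {f : α → E} (hf : StronglyMeasurable f)
    {C : ℝ} (hC : ∀ x, ‖f x‖ ≤ C) (B : E →L[ℝ] F →L[ℝ] G) :
    (μ.withDensityᵥ P).integral f B = ∫ x, B (f x) (P x) ∂μ := by
  have hfin : IsFiniteMeasure (μ.withDensityᵥ P).variation := by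
    rw [Measure.variation_withDensityᵥ hP]
    exact ⟨by simpa using! hP.2⟩
  have hint : ∀ g : SimpleFunc α E, (μ.withDensityᵥ P).Integrable g := fun g =>
    g.integrable_of_isFiniteMeasure
  have hint' : ∀ g : SimpleFunc α E, Integrable (fun x => B (g x) (P x)) μ := fun g => by
    obtain ⟨D, hD⟩ := g.exists_forall_norm_le
    refine Integrable.mono' (hP.norm.const_mul (‖B‖ * D))
      (B.aestronglyMeasurable_comp₂ g.stronglyMeasurable.aestronglyMeasurable
        hP.aestronglyMeasurable) (.of_forall fun x => ?_)
    exact (B.le_opNorm₂ _ _).trans (by gcongr; exact hD x)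
  have hsimple : ∀ g : SimpleFunc α E,
      (μ.withDensityᵥ P).integral g B = ∫ x, B (g x) (P x) ∂μ := by
    refine fun g => SimpleFunc.induction (fun c s hs => ?_) (fun g₁ g₂ _ h₁ h₂ => ?_) g
    · have h1 : ⇑(SimpleFunc.piecewise s hs (SimpleFunc.const α c) (SimpleFunc.const α 0)) =
          s.indicator fun _ => c := by
        ext x; by_cases hx : x ∈ s <;> simp [hx]
      have h2 : (fun x => B (s.indicator (fun _ => c) x) (P x)) =
          s.indicator fun x => B c (P x) := by
        ext x; by_cases hx : x ∈ s <;> simp [hx]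
      rw [h1, VectorMeasure.integral_indicator_const _ hs, withDensityᵥ_apply hP hs, h2,
        MeasureTheory.integral_indicator hs, (B c).integral_comp_comm hP.integrableOn]
    · rw [SimpleFunc.coe_add, VectorMeasure.integral_add (hint g₁) (hint g₂), h₁, h₂,
        ← integral_add (hint' g₁) (hint' g₂)]
      simp
  have hlim := fun x => hf.tendsto_approxBounded_of_norm_le (hC x)
  have hbd := fun (n : ℕ) (x : α) =>
    hf.norm_approxBounded_le (c := C) (n := n) (x := x) ((norm_nonneg _).trans (hC x))
  have hleft : Filter.Tendsto (fun n => (μ.withDensityᵥ P).integral (hf.approxBounded C n) B)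
      Filter.atTop (𝓝 ((μ.withDensityᵥ P).integral f B)) :=
    VectorMeasure.tendsto_integral_filter_of_norm_le_const
      (.of_forall fun n => (SimpleFunc.stronglyMeasurable _).aestronglyMeasurable)
      ⟨C, .of_forall fun n => .of_forall fun x => hbd n x⟩ (.of_forall hlim)
  refine tendsto_nhds_unique hleft ?_
  simp_rw [hsimple]
  refine tendsto_integral_of_dominated_convergence (fun x => ‖B‖ * C * ‖P x‖)
    (fun n => (hint' _).aestronglyMeasurable) (hP.norm.const_mul _)
    (fun n => .of_forall fun x => (B.le_opNorm₂ _ _).trans (by gcongr; exact hbd n x))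
    (.of_forall fun x => ?_)
  exact ((B.flip (P x)).continuous.tendsto _).comp (hlim x)

section VolumeElement

variable {k n N : ℕ} {S : Type*} [TopologicalSpace S] [ChartedSpace (Rn k) S]
  [MeasurableSpace S]

/-- A volume element is finite on compact sets, because its chart densities are locally
bounded. -/
theorem IsVolumeElement.isFiniteMeasureOnCompacts [T2Space S] [BorelSpace S] {μ : Measure S}
    (hμ : IsVolumeElement k μ) : IsFiniteMeasureOnCompacts μ := by
  have : IsLocallyFiniteMeasure μ := ⟨fun x => by
    set e := chartAt (Rn k) x
    have hx : x ∈ e.source := mem_chart_source _ x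
    obtain ⟨ρ, hρ, -, hA⟩ := hμ e (chart_mem_atlas _ x)
    obtain ⟨K, hKc, hKn, hKt⟩ : ∃ K, IsCompact K ∧ K ∈ 𝓝 (e x) ∧ K ⊆ e.target := by
      obtain ⟨K, h1, h2, h3⟩ := local_compact_nhds (e.open_target.mem_nhds (e.map_source hx))
      exact ⟨K, h3, h1, h2⟩
    have hcomp : IsCompact (e.symm '' K) := hKc.image_of_continuousOn (e.continuousOn_symm.mono hKt)
    have himg : e '' (e.symm '' K) = K := by
      rw [Set.image_image]
      exact (Set.image_congr fun y hy => e.right_inv (hKt hy)).trans (Set.image_id' K)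
    refine ⟨e.symm '' K, ?_, ?_⟩
    · rw [← e.symm_map_nhds_eq hx]
      exact Filter.image_mem_map hKn
    · rw [hA _ hcomp.measurableSet (by rintro _ ⟨y, hy, rfl⟩; exact e.map_target (hKt hy)), himg]
      obtain ⟨C, hC⟩ := hKc.exists_bound_of_continuousOn (hρ.continuousOn.mono hKt)
      exact setLIntegral_lt_top_of_le_nnreal hKc.measure_ne_top ⟨C.toNNReal, fun y hy =>
        ENNReal.ofReal_le_ofReal ((le_abs_self _).trans (hC y hy))⟩⟩
  infer_instance

omit [MeasurableSpace S] in
/-- The time derivative of a smooth function on `ℝ × S` is jointly continuous. -/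
theorem continuous_deriv_of_contMDiff [IsManifold (𝓡 k) ∞ S] {h : ℝ → S → ℝ}
    (hs : ContMDiff (𝓘(ℝ, ℝ).prod (𝓡 k)) 𝓘(ℝ, ℝ) ∞ fun p : ℝ × S => h p.1 p.2) :
    Continuous fun p : ℝ × S => deriv (fun t => h t p.2) p.1 := by
  rw [continuous_iff_continuousAt]
  intro p
  have h1 : ContMDiff ((𝓘(ℝ, ℝ).prod (𝓡 k)).prod 𝓘(ℝ, ℝ)) 𝓘(ℝ, ℝ) ∞
      (Function.uncurry fun (q : ℝ × S) (t : ℝ) => h t q.2) :=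
    hs.comp (contMDiff_snd.prodMk (contMDiff_snd.comp contMDiff_fst))
  have h2 := ContMDiffAt.mfderiv (m := 0) (x₀ := p) (fun (q : ℝ × S) (t : ℝ) => h t q.2)
    (fun q => q.1) h1.contMDiffAt contMDiff_fst.contMDiffAt (by simp)
  have h3 : ContinuousAt (fun q : ℝ × S => fderiv ℝ (fun t => h t q.2) q.1) p := by
    convert! h2.continuousAt using 1
    refine Eq.trans ?_ (inTangentCoordinates_model_space (I := 𝓘(ℝ, ℝ)) (I' := 𝓘(ℝ, ℝ))
      (fun q : ℝ × S => q.1) (fun q => h q.1 q.2)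
      (fun q => mfderiv 𝓘(ℝ, ℝ) 𝓘(ℝ, ℝ) (fun t => h t q.2) q.1) p).symm
    simp only [mfderiv_eq_fderiv]
  exact h3.clm_apply (continuousAt_const (y := (1 : ℝ)))

/-- Differentiation under the integral sign, for a smooth integrand whose support stays in a
compact set for small times. -/
theorem hasDerivAt_integral_of_contMDiff [T2Space S] [SecondCountableTopology S] [BorelSpace S]
    [IsManifold (𝓡 k) ∞ S] {μ : Measure S} [IsFiniteMeasureOnCompacts μ] {h : ℝ → S → ℝ}
    (hs : ContMDiff (𝓘(ℝ, ℝ).prod (𝓡 k)) 𝓘(ℝ, ℝ) ∞ fun p : ℝ × S => h p.1 p.2)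
    {K : Set S} (hK : IsCompact K) (hz : ∀ᶠ t in 𝓝 (0 : ℝ), ∀ s ∉ K, h t s = 0) {h' : S → ℝ}
    (hd : ∀ s, HasDerivAt (fun t => h t s) (h' s) 0) :
    HasDerivAt (fun t => ∫ s, h t s ∂μ) (∫ s, h' s ∂μ) 0 := by
  have hD := continuous_deriv_of_contMDiff hs
  have hder : ∀ t s, HasDerivAt (fun t => h t s) (deriv (fun t => h t s) t) t := fun t s => by
    have : ContMDiff 𝓘(ℝ, ℝ) 𝓘(ℝ, ℝ) ∞ fun t => h t s :=
      hs.comp (contMDiff_id.prodMk contMDiff_const)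
    exact (this.contDiff.differentiable (by simp) t).hasDerivAt
  have hcont : ∀ t, Continuous fun s => h t s := fun t =>
    hs.continuous.comp (Continuous.prodMk_right t)
  obtain ⟨U, hU, hUo, hU0⟩ := eventually_nhds_iff.1 hz
  obtain ⟨δ, hδ, hδU⟩ := Metric.nhds_basis_closedBall.mem_iff.1 (hUo.mem_nhds hU0)
  obtain ⟨C, hC⟩ := ((isCompact_closedBall (0 : ℝ) δ).prod hK).exists_bound_of_continuousOn
    hD.continuousOn
  have hsupp : ∀ t ∈ U, HasCompactSupport fun s => h t s := fun t ht =>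
    HasCompactSupport.intro hK (hU t ht)
  have hres := hasDerivAt_integral_of_dominated_loc_of_deriv_le (μ := μ) (F := h) (x₀ := (0 : ℝ))
    (s := Metric.ball 0 δ) (F' := fun t s => deriv (fun t => h t s) t)
    (bound := K.indicator fun _ => C) (Metric.ball_mem_nhds _ hδ)
    (.of_forall fun t => (hcont t).aestronglyMeasurable)
    ((hcont 0).integrable_of_hasCompactSupport (hsupp 0 hU0))
    (hD.comp (Continuous.prodMk_right (0 : ℝ))).aestronglyMeasurable
    (.of_forall fun s t ht => ?_)
    ((integrable_indicator_iff hK.measurableSet).2 (integrableOn_const hK.measure_ne_top))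
    (.of_forall fun s t _ => hder t s)
  · convert! hres.2 using 2
    ext s
    exact (hd s).deriv.symm
  · have ht' := Metric.ball_subset_closedBall ht
    by_cases hsK : s ∈ K
    · rw [Set.indicator_of_mem hsK]
      exact hC (t, s) ⟨ht', hsK⟩
    · rw [Set.indicator_of_notMem hsK]
      have : (fun t => h t s) =ᶠ[𝓝 t] fun _ => 0 := by
        filter_upwards [hUo.mem_nhds (hδU ht')] with τ hτ using hU τ hτ s hsK
      rw [this.deriv_eq]
      simp

end VolumeElement

/-! ### The derivative of an inverse diffeomorphism -/

theorem fderiv_inv_comp_fderiv {n : ℕ} (η : DiffRn n) (x : Rn n) :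
    (fderiv ℝ (η⁻¹ : DiffRn n) (η x)).comp (fderiv ℝ η x) = .id ℝ (Rn n) := by
  have h := fderiv_comp x (g := (η⁻¹ : DiffRn n)) (f := η)
    ((η⁻¹ : DiffRn n).contDiff.differentiable (by simp) _) (η.contDiff.differentiable (by simp) _)
  rw [show ((η⁻¹ : DiffRn n) : Rn n → Rn n) ∘ η = id from funext η.symm_apply_apply,
    fderiv_id] at h
  exact h.symm

theorem fderiv_comp_fderiv_inv {n : ℕ} (η : DiffRn n) (x : Rn n) :
    (fderiv ℝ η x).comp (fderiv ℝ (η⁻¹ : DiffRn n) (η x)) = .id ℝ (Rn n) := by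
  have h := fderiv_inv_comp_fderiv η⁻¹ (η x)
  rwa [inv_inv, show (η⁻¹ : DiffRn n) (η x) = x from η.symm_apply_apply x] at h

theorem fderiv_inv_apply {n : ℕ} (η : DiffRn n) (x : Rn n) :
    fderiv ℝ (η⁻¹ : DiffRn n) (η x) = (fderiv ℝ η x).inverse :=
  (ContinuousLinearMap.inverse_eq (fderiv_comp_fderiv_inv η x) (fderiv_inv_comp_fderiv η x)).symm

theorem isInvertible_fderiv {n : ℕ} (η : DiffRn n) (x : Rn n) : (fderiv ℝ η x).IsInvertible :=
  ⟨.equivOfInverse' _ _ (fderiv_comp_fderiv_inv η x) (fderiv_inv_comp_fderiv η x), rfl⟩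

/-! ### Derivatives along a curve of diffeomorphisms -/

namespace IsDiffCurve

variable {n : ℕ} {η : ℝ → DiffRn n} {X : VF n} (h : IsDiffCurve η X)
include h

theorem contDiff_fderiv : ContDiff ℝ ∞ fun p : ℝ × Rn n => fderiv ℝ (η p.1) p.2 :=
  ContDiff.fderiv (f := fun (p : ℝ × Rn n) x => η p.1 x) (g := Prod.snd)
    (h.smooth.comp ((contDiff_fst.comp contDiff_fst).prodMk contDiff_snd)) contDiff_snd (by simp)

theorem contDiff_fderiv_inv :
    ContDiff ℝ ∞ fun p : ℝ × Rn n => fderiv ℝ ((η p.1)⁻¹ : DiffRn n) (η p.1 p.2) := by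
  simp_rw [fderiv_inv_apply]
  rw [contDiff_iff_contDiffAt]
  exact fun p => ContDiffAt.comp (g := ContinuousLinearMap.inverse)
    (f := fun p : ℝ × Rn n => fderiv ℝ (η p.1) p.2) p
    (isInvertible_fderiv (η p.1) p.2).contDiffAt_map_inverse h.contDiff_fderiv.contDiffAt

theorem fderiv_zero (x : Rn n) : fderiv ℝ (η 0) x = ContinuousLinearMap.id ℝ (Rn n) := by
  rw [h.zero]
  exact fderiv_id

/-- The spatial derivative `Dη_t` has initial velocity `DX`, by the symmetry of the second
derivative of `(t, x) ↦ η_t x`. -/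
theorem hasDerivAt_fderiv (x : Rn n) :
    HasDerivAt (fun t => fderiv ℝ (η t) x) (fderiv ℝ X.1 x) 0 := by
  set f : ℝ × Rn n → Rn n := fun p => η p.1 p.2 with hf
  have hfs : ContDiff ℝ ∞ f := h.smooth
  have hfd : ∀ p, HasFDerivAt f (fderiv ℝ f p) p := fun p =>
    (hfs.differentiable (by simp) p).hasFDerivAt
  have hf2 : ∀ p, HasFDerivAt (fderiv ℝ f) (fderiv ℝ (fderiv ℝ f) p) p := fun p =>
    ((hfs.fderiv_right (m := ∞) (by simp)).differentiable (by simp) p).hasFDerivAt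
  have h1 : ∀ t, fderiv ℝ (η t) x = (fderiv ℝ f (t, x)).comp (.inr ℝ ℝ (Rn n)) := fun t =>
    ((hfd (t, x)).comp x (hasFDerivAt_prodMk_right t x)).fderiv
  have h2 : ∀ y, X.1 y = fderiv ℝ f (0, y) (1, 0) := fun y => by
    have := (hfd (0, y)).comp_hasDerivAt (0 : ℝ)
      ((hasDerivAt_id (0 : ℝ)).prodMk (hasDerivAt_const (0 : ℝ) y))
    exact (h.velocity y).unique this
  have h3 : HasFDerivAt X.1 (((ContinuousLinearMap.apply ℝ (Rn n) ((1, 0) : ℝ × Rn n)).comp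
      (fderiv ℝ (fderiv ℝ f) (0, x))).comp (.inr ℝ ℝ (Rn n))) x := by
    rw [show X.1 = fun y => fderiv ℝ f (0, y) (1, 0) from funext h2]
    exact (ContinuousLinearMap.apply ℝ (Rn n) ((1, 0) : ℝ × Rn n)).hasFDerivAt.comp x
      ((hf2 (0, x)).comp x (hasFDerivAt_prodMk_right (0 : ℝ) x))
  have h4 : HasDerivAt (fun t : ℝ => fderiv ℝ f (t, x))
      (fderiv ℝ (fderiv ℝ f) (0, x) (1, 0)) 0 :=
    (hf2 (0, x)).comp_hasDerivAt (0 : ℝ)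
      ((hasDerivAt_id (0 : ℝ)).prodMk (hasDerivAt_const (0 : ℝ) x))
  have h5 := h4.clm_comp (hasDerivAt_const (0 : ℝ) (ContinuousLinearMap.inr ℝ ℝ (Rn n)))
  simp_rw [h1]
  convert! h5 using 1
  rw [h3.fderiv]
  ext1 v
  have hsymm : IsSymmSndFDerivAt ℝ f (0, x) := hfs.contDiffAt.isSymmSndFDerivAt
    (by simpa using! (WithTop.coe_le_coe.2 le_top : ((2 : ℕ∞) : WithTop ℕ∞) ≤ ∞))
  simpa using! hsymm (0, v) (1, 0)

theorem hasDerivAt_fderiv_inv (x : Rn n) :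
    HasDerivAt (fun t => fderiv ℝ ((η t)⁻¹ : DiffRn n) (η t x)) (-fderiv ℝ X.1 x) 0 := by
  simp_rw [fderiv_inv_apply]
  have h1 := hasFDerivAt_ringInverse (𝕜 := ℝ) (1 : (Rn n →L[ℝ] Rn n)ˣ)
  rw [ContinuousLinearMap.ringInverse_eq_inverse] at h1
  have h2 := h1.comp_hasDerivAt_of_eq (0 : ℝ) (h.hasDerivAt_fderiv x) (h.fderiv_zero x).symm
  convert! h2 using 1

end IsDiffCurve

/-! ### Infinitesimal generators -/

variable {k n N : ℕ} {S : Type*} [TopologicalSpace S] [ChartedSpace (Rn k) S]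

/-- The vector field `X ∘ Q` over the embedding `Q`. It is both the value at `Q` of the
infinitesimal generator of `X` on `Emb(S, ℝⁿ)` and the functional derivative `δ⟨J, X⟩/δP`. -/
def alongEmb (X : VF n) (Q : Emb k n S) : TanEmb k n S :=
  ⟨fun s => X (Q s), X.contDiff.comp_contMDiff Q.isSmoothEmbedding.contMDiff⟩

/-- The one-form density `P ∘ DX(Q)`. It is the functional derivative `δ⟨J, X⟩/δQ`, and the
negative of the momentum component of the infinitesimal generator. -/
noncomputable def transportMom (X : VF n) (z : CotEmb k n S) : Mom k n S :=
  ⟨fun s => (z.P s).comp (fderiv ℝ X.1 (z.Q s)), by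
    have h2 : ContDiff ℝ ∞ (fderiv ℝ X.1) := X.contDiff.fderiv_right (by simp)
    exact z.P.smooth.clm_comp (h2.comp_contMDiff z.Q.isSmoothEmbedding.contMDiff), by
    refine z.P.compact.mono fun s hs => ?_
    simp only [Function.mem_support] at hs ⊢
    intro h
    exact hs (by rw [h, ContinuousLinearMap.zero_comp])⟩

instance : Neg (Mom k n S) := ⟨fun P => ⟨fun s => -P s, P.smooth.neg, P.compact.neg⟩⟩

/-- The infinitesimal generator of `X` at a point of `T*Emb(S, ℝⁿ)^N`. -/
noncomputable def cotGenerator (X : VF n) (z : Fin N → CotEmb k n S) : Fin N → TanCot k n S :=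
  fun a => ⟨alongEmb X (z a).Q, -transportMom X (z a)⟩

theorem IsDiffCurve.contMDiff_apply {η : ℝ → DiffRn n} {X : VF n} (h : IsDiffCurve η X)
    (Q : Emb k n S) : ContMDiff (𝓘(ℝ, ℝ).prod (𝓡 k)) 𝓘(ℝ, Rn n) ∞
      fun p : ℝ × S => η p.1 (Q p.2) :=
  h.smooth.comp_contMDiff
    (contMDiff_fst.prodMk_space (Q.isSmoothEmbedding.contMDiff.comp contMDiff_snd))

theorem isEmbGenerator_alongEmb (X : VF n) (Q : Fin N → Emb k n S) :
    IsEmbGenerator X Q fun a => alongEmb X (Q a) := by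
  refine ⟨exists_isDiffCurve X, fun η h => ⟨fun a => h.contMDiff_apply (Q a), ?_, fun a s =>
    h.velocity _⟩⟩
  simp only [h.zero, one_smul]

theorem isCotGenerator_cotGenerator (X : VF n) (z : Fin N → CotEmb k n S) :
    IsCotGenerator X z (cotGenerator X z) := by
  refine ⟨exists_isDiffCurve X, fun η h => ⟨fun a => h.contMDiff_apply (z a).Q, fun a => ?_,
    fun a t₀ => ⟨tsupport (z a).P, (z a).P.compact, .of_forall fun t s hs => ?_⟩, ?_,
    fun a s => h.velocity _, fun a s => ?_⟩⟩
  · exact ((z a).P.smooth.comp contMDiff_snd).clm_comp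
      (h.contDiff_fderiv_inv.comp_contMDiff (contMDiff_fst.prodMk_space
        ((z a).Q.isSmoothEmbedding.contMDiff.comp contMDiff_snd)))
  · change ((z a).P s).comp _ = 0
    rw [image_eq_zero_of_notMem_tsupport hs, ContinuousLinearMap.zero_comp]
  · simp only [h.zero, one_smul]
  · have := (hasDerivAt_const (0 : ℝ) ((z a).P s)).clm_comp (h.hasDerivAt_fderiv_inv ((z a).Q s))
    convert! this using 1
    change -((z a).P s).comp _ = _
    simp

theorem HasEmbVelocity.smul (η : DiffRn n) {c : ℝ → Fin N → Emb k n S} {Q : Fin N → Emb k n S}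
    {V : Fin N → TanEmb k n S} (h : HasEmbVelocity c Q V) :
    HasEmbVelocity (fun t => η • c t) (η • Q) fun a => tangentMap η (Q a) (V a) := by
  refine ⟨fun a => η.contDiff.comp_contMDiff (h.smooth a), ?_, fun a s => ?_⟩
  · simp only [h.zero]
  · have h0 : c 0 a s = Q a s := by rw [h.zero]
    exact ((η.contDiff.differentiable (by simp)
      (Q a s)).hasFDerivAt).comp_hasDerivAt_of_eq (0 : ℝ) (h.velocity a s) h0.symm

theorem VF.continuous (X : VF n) : Continuous X.1 := X.contDiff.continuous

theorem Emb.continuous (Q : Emb k n S) : Continuous Q := Q.isSmoothEmbedding.contMDiff.continuous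

section Pairing

variable [MeasurableSpace S] {μ : Measure S}

omit [MeasurableSpace S] in
theorem liftMom_tangentMap (η : DiffRn n) (z : CotEmb k n S) (V : TanEmb k n S) (s : S) :
    (η • z).P s (tangentMap η z.Q V s) = z.P s (V s) := by
  change z.P s (fderiv ℝ (η⁻¹ : DiffRn n) (η (z.Q s)) (fderiv ℝ η (z.Q s) (V s))) = _
  obtain ⟨e, he⟩ := isInvertible_fderiv η (z.Q s)
  rw [fderiv_inv_apply, ← he]
  simp

theorem pairing_neg_left (P : Fin N → Mom k n S) (V : Fin N → TanEmb k n S) :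
    pairing μ (fun a => -P a) V = -pairing μ P V := by
  simp only [pairing, ← Finset.sum_neg_distrib, ← integral_neg]
  rfl

theorem integrable_mom_apply [T2Space S] [SecondCountableTopology S] [BorelSpace S]
    [IsFiniteMeasureOnCompacts μ] (P : Mom k n S) {V : S → Rn n} (hV : Continuous V) :
    Integrable (fun s => P s (V s)) μ := by
  refine (P.smooth.continuous.clm_apply hV).integrable_of_hasCompactSupport
    (P.compact.mono fun s hs => ?_)
  simp only [Function.mem_support] at hs ⊢
  intro h
  exact hs (by rw [h, zero_apply])

end Pairing

/-! ### The singular momentum map -/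

section Momentum

variable [T2Space S] [SecondCountableTopology S] [MeasurableSpace S] [BorelSpace S]

/-- The momentum `J(Q, P) ∈ 𝔛(ℝⁿ)*`, `⟨J(Q, P), X⟩ = ∑_a ∫_S P^a(s) · X(Q^a(s)) ds`. -/
noncomputable def singularMomentum (μ : Measure S) [IsFiniteMeasureOnCompacts μ]
    (z : Fin N → CotEmb k n S) : VF n →L[ℝ] ℝ where
  toFun X := ∑ a, ∫ s, (z a).P s (X ((z a).Q s)) ∂μ
  map_add' X Y := by
    rw [← Finset.sum_add_distrib]
    refine Finset.sum_congr rfl fun a _ => ?_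
    refine Eq.trans (integral_congr_ae (.of_forall fun s => ?_))
      (integral_add (integrable_mom_apply _ (X.continuous.comp (z a).Q.continuous))
        (integrable_mom_apply _ (Y.continuous.comp (z a).Q.continuous)))
    exact map_add ((z a).P s) _ _
  map_smul' r X := by
    rw [RingHom.id_apply, smul_eq_mul, Finset.mul_sum]
    refine Finset.sum_congr rfl fun a _ => ?_
    rw [← integral_const_mul]
    exact integral_congr_ae (.of_forall fun s => map_smul ((z a).P s) r _)
  cont := by
    refine continuous_finsetSum _ fun a _ => ?_
    -- Uniform convergence of the fields themselves on compact sets is enough: the functional factors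
    -- through the jet of order zero.
    have hjet : Continuous (VF.jet (n := n) 0) := continuous_iInf_dom continuous_induced_dom
    have hΦ : Continuous fun f : C(Rn n, Rn n [×0]→L[ℝ] Rn n) =>
        ∫ s, (z a).P s (f ((z a).Q s) 0) ∂μ := by
      rw [← continuousOn_univ]
      refine continuousOn_integral_of_compact_support (k := tsupport (z a).P) (z a).P.compact
        (Continuous.continuousOn ?_) fun f s _ hs => ?_
      · have h1 : Continuous fun q : C(Rn n, Rn n [×0]→L[ℝ] Rn n) × S => q.1 ((z a).Q q.2) :=
          continuous_fst.eval ((z a).Q.continuous.comp continuous_snd)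
        exact ((z a).P.smooth.continuous.comp continuous_snd).clm_apply
          ((ContinuousMultilinearMap.apply ℝ (fun _ : Fin 0 => Rn n) (Rn n) 0).continuous.comp h1)
      · rw [image_eq_zero_of_notMem_tsupport hs, zero_apply]
    exact hΦ.comp hjet

variable {μ : Measure S} [IsFiniteMeasureOnCompacts μ]

theorem singularMomentum_apply (z : Fin N → CotEmb k n S) (X : VF n) :
    singularMomentum μ z X = ∑ a, ∫ s, (z a).P s (X ((z a).Q s)) ∂μ := rfl

omit [SecondCountableTopology S] in
/-- Continuous functions, bounded or not, can be integrated against the vector measure with the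
compactly supported density `P`. -/
theorem integral_withDensityᵥ_mom (P : Mom k n S) {f : S → Rn n} (hf : Continuous f) :
    (μ.withDensityᵥ P).Integrable f ∧
      (μ.withDensityᵥ P).integral f (ContinuousLinearMap.id ℝ (Rn n →L[ℝ] ℝ)).flip =
        ∫ s, P s (f s) ∂μ := by
  have hP : Integrable P μ := P.smooth.continuous.integrable_of_hasCompactSupport P.compact
  have hν := Measure.variation_withDensityᵥ hP
  have hK : MeasurableSet (tsupport P) := P.compact.measurableSet
  obtain ⟨C, hC⟩ := P.compact.exists_bound_of_continuousOn hf.continuousOn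
  have hmeas : StronglyMeasurable ((tsupport P).indicator f) := hf.stronglyMeasurable.indicator hK
  have hbd : ∀ s, ‖(tsupport P).indicator f s‖ ≤ max C 0 := fun s => by
    by_cases hs : s ∈ tsupport P
    · rw [Set.indicator_of_mem hs]
      exact (hC s hs).trans (le_max_left _ _)
    · simp [Set.indicator_of_notMem hs]
  -- The variation of the measure lives on the support of `P`, where `f` is bounded.
  have hae : (tsupport P).indicator f =ᵐ[(μ.withDensityᵥ P).variation] f := by
    have h0 : ∀ᵐ s ∂(μ.withDensityᵥ P).variation, s ∈ tsupport P := by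
      rw [ae_iff, hν]
      change (μ.withDensity _) (tsupport P)ᶜ = 0
      rw [withDensity_apply _ hK.compl]
      refine setLIntegral_eq_zero hK.compl fun s hs => ?_
      simp [image_eq_zero_of_notMem_tsupport hs]
    filter_upwards [h0] with s hs using Set.indicator_of_mem hs f
  have hfin : IsFiniteMeasure (μ.withDensityᵥ P).variation := by
    rw [hν]
    exact ⟨by simpa using! hP.2⟩
  refine ⟨(Integrable.of_bound hmeas.aestronglyMeasurable (max C 0) (.of_forall hbd)).congr hae, ?_⟩
  rw [← VectorMeasure.integral_congr_ae hae, integral_withDensityᵥ hP hmeas hbd]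
  refine integral_congr_ae (.of_forall fun s => ?_)
  by_cases hs : s ∈ tsupport P
  · simp [Set.indicator_of_mem hs]
  · simp [image_eq_zero_of_notMem_tsupport hs]

omit [SecondCountableTopology S] in
/-- The measure-valued ansatz pairs with `X` as `⟨J(Q, P), X⟩` does. -/
theorem measurePairing_ansatz (z : Fin N → CotEmb k n S) (X : VF n) :
    measurePairing (ansatz μ z) X = ∑ a, ∫ s, (z a).P s (X ((z a).Q s)) ∂μ := by
  have h := fun a => integral_withDensityᵥ_mom (μ := μ) (z a).P
    (X.continuous.comp (z a).Q.continuous)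
  have hm := fun a => (z a).Q.continuous.measurable
  have hX : ∀ ν : Measure (Rn n), AEStronglyMeasurable X.1 ν := fun ν =>
    X.continuous.aestronglyMeasurable
  rw [measurePairing, ansatz, VectorMeasure.integral_finsetSum_vectorMeasure fun a _ =>
    VectorMeasure.Integrable.map (hX _) (h a).1]
  exact Finset.sum_congr rfl fun a _ =>
    (VectorMeasure.integral_map (hm a) (hX _) (h a).1).trans (h a).2

theorem hasFunctionalDeriv_singularMomentum [IsManifold (𝓡 k) ∞ S] (X : VF n)
    (z : Fin N → CotEmb k n S) :
    HasFunctionalDeriv μ (fun w => singularMomentum μ w X) z (fun a => transportMom X (z a))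
      fun a => alongEmb X (z a).Q := by
  intro c v h
  have hX := X.contDiff
  simp only [singularMomentum_apply, pairing, ← Finset.sum_add_distrib]
  refine HasDerivAt.fun_sum fun a _ => ?_
  rw [← integral_add (integrable_mom_apply _ (v a).dQ.smooth.continuous)
    (integrable_mom_apply _ (alongEmb X (z a).Q).smooth.continuous)]
  obtain ⟨K, hK, hz⟩ := h.support a 0
  refine hasDerivAt_integral_of_contMDiff
    ((h.smooth_P a).clm_apply (hX.comp_contMDiff (h.smooth_Q a))) hK ?_ fun s => ?_
  · filter_upwards [hz] with t ht s hs
    rw [ht s hs, zero_apply]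
  · have hQ0 : (c 0 a).Q s = (z a).Q s := by rw [h.zero]
    have hP0 : (c 0 a).P s = (z a).P s := by rw [h.zero]
    have h1 := (hX.differentiable (by simp) ((z a).Q s)).hasFDerivAt.comp_hasDerivAt_of_eq (0 : ℝ)
      (h.velocity_Q a s) hQ0.symm
    have h2 := (h.velocity_P a s).clm_apply h1
    convert! h2 using 1
    rw [add_comm, hP0]
    simp only [Function.comp_apply, hQ0]
    rfl

/-- Both sides integrate `P(s) · D(η⁻¹)(η(Q s)) X(η(Q s))`. -/
theorem isEquivariant_singularMomentum :
    IsEquivariant (singularMomentum μ : (Fin N → CotEmb k n S) → VF n →L[ℝ] ℝ) := by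
  intro η z X
  rfl

theorem isMomentumMap_singularMomentum [IsManifold (𝓡 k) ∞ S] :
    IsMomentumMap μ (singularMomentum μ : (Fin N → CotEmb k n S) → VF n →L[ℝ] ℝ) where
  hamiltonian X z := by
    refine ⟨cotGenerator X z, isCotGenerator_cotGenerator X z, fun c w h => ?_⟩
    convert hasFunctionalDeriv_singularMomentum X z c w h using 1
    rw [symplecticForm]
    simp only [cotGenerator]
    rw [pairing_neg_left]
    ring
  poisson X z := by
    refine ⟨_, _, hasFunctionalDeriv_singularMomentum X z, fun F A B hF η hη => ?_⟩
    convert hF _ _ ((isCotGenerator_cotGenerator X z).2 η hη) using 1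
    rw [poissonBracket]
    simp only [cotGenerator]
    rw [pairing_neg_left]
    ring
  cotangent X z := ⟨_, isEmbGenerator_alongEmb X _, rfl⟩

end Momentum

end SingMom

theorem theorem1 (k n N : ℕ) (S : Type*) [TopologicalSpace S] [T2Space S]
    [SecondCountableTopology S] [ChartedSpace (SingMom.Rn k) S] [IsManifold (𝓡 k) ∞ S]
    [MeasurableSpace S] [BorelSpace S] (μ : Measure S) (hμ : SingMom.IsVolumeElement k μ) :
    -- the action on `T*Emb(S, ℝⁿ)` is the cotangent lift of the action `η · Q = η ∘ Q`
    (∀ (η : SingMom.DiffRn n) (c : ℝ → Fin N → SingMom.Emb k n S) (Q : Fin N → SingMom.Emb k n S)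
        (V : Fin N → SingMom.TanEmb k n S), SingMom.HasEmbVelocity c Q V →
      SingMom.HasEmbVelocity (fun t => η • c t) (η • Q)
        (fun a => SingMom.tangentMap η (Q a) (V a))) ∧
    (∀ (η : SingMom.DiffRn n) (z : Fin N → SingMom.CotEmb k n S)
        (V : Fin N → SingMom.TanEmb k n S),
      SingMom.pairing μ (fun a => ((η • z) a).P)
          (fun a => SingMom.tangentMap η (z a).Q (V a)) =
        SingMom.pairing μ (fun a => (z a).P) V) ∧
    -- the ansatz defines an equivariant momentum map
    ∃ J : (Fin N → SingMom.CotEmb k n S) → (SingMom.VF n →L[ℝ] ℝ),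
      (∀ z X, J z X = SingMom.measurePairing (SingMom.ansatz μ z) X) ∧
      SingMom.IsMomentumMap μ J ∧
      SingMom.IsEquivariant J ∧
      ∀ z X, (∀ a, Integrable (fun s => (z a).P s (X ((z a).Q s))) μ) ∧
        J z X = ∑ a, ∫ s, (z a).P s (X ((z a).Q s)) ∂μ := by
  have := hμ.isFiniteMeasureOnCompacts
  refine ⟨fun η _ _ _ h => h.smul η, fun η z V => ?_, SingMom.singularMomentum μ,
    fun z X => (SingMom.measurePairing_ansatz z X).symm, SingMom.isMomentumMap_singularMomentum,
    SingMom.isEquivariant_singularMomentum, fun z X => ⟨fun a =>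
      SingMom.integrable_mom_apply _ (X.continuous.comp (z a).Q.continuous), rfl⟩⟩
  exact Finset.sum_congr rfl fun a _ => integral_congr_ae
    (.of_forall fun s => SingMom.liftMom_tangentMap η (z a) (V a) s)
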